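/- **First Incompleteness Theorem.** Let $L$ be a first-order language with equality whose function and relation symbols are numbered injectively by natural numbers, and which has a constant symbol $0$ and a unary function symbol $S$; write $\bar n$ for the numeral $S\cdots S0$ with $n$ occurrences of $S$. Formulas are strings, and are identified with natural numbers through a fixed Gödel numbering $A\mapsto \#A$. A *theory* is a set $T$ of $L$-sentences closed under logical consequence; $T\vdash A$ means $A\in T$. A *proof verifier* for $T$ is a function $\mathrm{pc}\colon\mathbb N^2\to\{✗,✓\}$ such that, for every sentence $A$, if $T\vdash A$ then $\mathrm{pc}(p,\#A)=✓$ for some $p$, and otherwise $\mathrm{pc}(p,\#A)=✗$ for all $p$ (when this holds with $✓$ we say that $p$ proves $A$; as numbers, $✗=0$ and $✓=1$). $T$ is *computably enumerable* if it has a computable proof verifier. A formula $F$ with $k+1$ free variables *represents* a partial function $f\colon\mathbb N^k\rightharpoonup\mathbb N$ in $T$ if $T\vdash(\exists! y\,F(\bar x_1,\dots,\bar x_k,y))\wedge F(\bar x_1,\dots,\bar x_k,\bar y)$ whenever $f(x_1,\dots,x_k)=y$; in this case $f(\bar x_1,\dots,\bar x_k)=\bar z$ abbreviates the sentence $(\exists!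 y\,F(\bar x_1,\dots,\bar x_k,y))\wedge\exists y\,(F(\bar x_1,\dots,\bar x_k,y)\wedge y=\bar z)$. Let $T$ be a consistent, computably enumerable theory in $L$ which contains the axioms of successorship $$\forall x\,\neg\,Sx=0,\qquad \forall x,y\,(Sx=Sy\to x=y),\qquad \forall x\,(x=0\vee\exists y\,Sy=x),$$ and in which every (partial) computable function is represented by some formula. Then $T$ is incomplete: there is a sentence $A$ with $T\nvdash A$ and $T\nvdash\neg A$. Moreover, let $\mathrm{pc}$ be any computable proof verifier for $T$. There is a partial computable function $X\colon\mathbb N\rightharpoonup\mathbb N$ which, on input $\#F$ for a formula $F$ with two free variables (regarded as a representation of a function $f$), goes through $p=0,1,2,\dots$, returns $✓$ as soon as $p$ proves $\neg\, f(\overline{\#F})=\bar ✓$, returns $✗$ as soon as $p$ proves $f(\overline{\#F})=\bar ✓$ (for each $p$ the first condition is tested first), and does not halt if neither ever happens; on other inputs its behaviour is arbitrary. Every such partial computable $X$ has a representation in $T$, and for every formula $F$ which represents $X$ in $T$, the sentence $$R\;:=\;\neg\,X(\overline{\#F})=\bar ✓$$ is neither provable nor refutable: $T\nvdash R$ and $T\nvdash\neg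 R$. -/

import Mathlib

universe u v

namespace Incompleteness

open FirstOrder FirstOrder.Language

/-! ### First-order theories -/

section Theories

variable {L : FirstOrder.Language.{u, v}}

/-- A theory in the sense used here: a set of sentences closed under logical consequence.
For such a set, "`T` proves `A`" means `A ∈ T`. -/
def IsDeductivelyClosed (T : L.Theory) : Prop :=
  ∀ A : L.Sentence, T ⊨ᵇ A → A ∈ T

/-- No sentence is both provable and refutable. -/
def IsConsistent (T : L.Theory) : Prop :=
  ∀ A : L.Sentence, ¬ (A ∈ T ∧ Formula.not A ∈ T)

/-- Some sentence is neither provable nor refutable. -/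
def IsIncomplete (T : L.Theory) : Prop :=
  ∃ A : L.Sentence, A ∉ T ∧ Formula.not A ∉ T

end Theories

/-! ### Formulas as strings, strings as numbers -/

section Strings

variable {L : FirstOrder.Language.{u, v}} [Encodable (Σ n, L.Functions n)] [Encodable (Σ n, L.Relations n)]

/-- A term, written in prefix notation. The letters are natural numbers: `3 a + 4` is the variable
number `a`, and `3 a + 5` is the function symbol number `a`. -/
def termString {β : Type} [Encodable β] : L.Term β → List ℕ
  | .var b => [3 * Encodable.encode b + 4]
  | .func (l := l) f ts =>
      (3 * Encodable.encode (⟨l, f⟩ : Σ n, L.Functions n) + 5) ::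
        (List.finRange l).flatMap fun i => termString (ts i)

/-- A formula, written in prefix notation. The letters `0`, `1`, `2`, `3` are falsum, equality,
implication and the universal quantifier, and `3 a + 6` is the relation symbol number `a`. -/
def formulaString {α : Type} [Encodable α] : ∀ {n : ℕ}, L.BoundedFormula α n → List ℕ
  | _, .falsum => [0]
  | _, .equal t₁ t₂ => 1 :: (termString t₁ ++ termString t₂)
  | _, .rel (l := l) R ts =>
      (3 * Encodable.encode (⟨l, R⟩ : Σ n, L.Relations n) + 6) ::
        (List.finRange l).flatMap fun i => termString (ts i)
  | _, .imp A B => 2 :: (formulaString A ++ formulaString B)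
  | _, .all A => 3 :: formulaString A

/-- The number of a formula: its string, read as a natural number. -/
def code {α : Type} [Encodable α] (A : L.Formula α) : ℕ :=
  Encodable.encode (formulaString A)

/-- `pc p x` says whether `p` is accepted as a proof of the sentence with number `x`
(`true` is acceptance): provable sentences have an accepted `p`, all other sentences have none. -/
def IsProofVerifier (T : L.Theory) (pc : ℕ → ℕ → Bool) : Prop :=
  ∀ A : L.Sentence,
    (A ∈ T → ∃ p, pc p (code A) = true) ∧ (A ∉ T → ∀ p, pc p (code A) = false)

/-- There is a computable proof verifier. -/
def IsComputablyEnumerable (T : L.Theory) : Prop :=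
  ∃ pc : ℕ → ℕ → Bool, Computable₂ pc ∧ IsProofVerifier T pc

end Strings

/-! ### Representation of functions -/

section Representation

variable {L : FirstOrder.Language.{u, v}}

/-- The axioms of successorship: `∀ x, ¬ S x = 0`; `∀ x y, S x = S y → x = y`; and
`∀ x, x = 0 ∨ ∃ y, S y = x`. -/
def successorAxioms (zero : L.Constants) (succ : L.Functions 1) : L.Theory :=
  {∀' ∼((succ.apply₁ (&0)) =' zero.term),
   ∀' ∀' (((succ.apply₁ (&0)) =' (succ.apply₁ (&1))) ⟹ ((&0) =' (&1))),
   ∀' (((&0) =' zero.term) ⊔ ∃' ((succ.apply₁ (&1)) =' (&0)))}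

/-- The numeral `S … S 0` with `x` occurrences of `S`. -/
def numeral (zero : L.Constants) (succ : L.Functions 1) {β : Type} : ℕ → L.Term β
  | 0 => zero.term
  | x + 1 => succ.apply₁ (numeral zero succ x)

/-- The formula `F(x₁, …, x_k, t)`, with numerals put for the first `k` variables of `F` and the
term `t` for the last one. -/
def applyTo (zero : L.Constants) (succ : L.Functions 1) {k : ℕ} {β : Type}
    (F : L.Formula (Fin (k + 1))) (x : Fin k → ℕ) (t : L.Term β) : L.Formula β :=
  F.subst (Fin.snoc (α := fun _ => L.Term β) (fun i => numeral zero succ (x i)) t)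

/-- A formula `P` with one free variable, with that variable turned into the `j`-th of `n`
variables that are about to be quantified. -/
def atVar (P : L.Formula (Fin 1)) {n : ℕ} (j : Fin n) : L.BoundedFormula Empty n :=
  BoundedFormula.relabel (fun _ => Sum.inr j) P

/-- Unique existence: `∃ x, P(x) ∧ ∀ y, P(y) → y = x`. -/
def existsUnique (P : L.Formula (Fin 1)) : L.Sentence :=
  ∃' (atVar P (0 : Fin 1) ⊓ ∀' (atVar P (1 : Fin 2) ⟹ ((&1) =' (&0))))

/-- The formula `F` is a representation in `T` of the partial function `f`: whenever
`f(x) = y`, the theory proves `(∃! y, F(x, y)) ∧ F(x, y)` (with numerals for `x` and `y`). -/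
def IsRepresentation (zero : L.Constants) (succ : L.Functions 1) (T : L.Theory) {k : ℕ}
    (f : (Fin k → ℕ) →. ℕ) (F : L.Formula (Fin (k + 1))) : Prop :=
  ∀ (x : Fin k → ℕ) (y : ℕ), y ∈ f x →
    (existsUnique (applyTo zero succ F x (Term.var 0)) ⊓
      applyTo zero succ F x (numeral zero succ y) : L.Sentence) ∈ T

/-- Every partial computable function, of any number of arguments, has a representation in `T`. -/
def RepresentsEveryComputable (zero : L.Constants) (succ : L.Functions 1) (T : L.Theory) : Prop :=
  ∀ (k : ℕ) (f : (Fin k → ℕ) →. ℕ), Partrec f → ∃ F, IsRepresentation zero succ T f F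

/-- The sentence abbreviated by `f(x) = z`, where `F` is a representation of `f`:
`(∃! y, F(x, y)) ∧ (∃ y, F(x, y) ∧ y = z)` (with numerals for `x` and `z`). -/
def valueEq (zero : L.Constants) (succ : L.Functions 1) {k : ℕ}
    (F : L.Formula (Fin (k + 1))) (x : Fin k → ℕ) (z : ℕ) : L.Sentence :=
  existsUnique (applyTo zero succ F x (Term.var 0)) ⊓
    ∃' (atVar (applyTo zero succ F x (Term.var 0)) (0 : Fin 1) ⊓ ((&0) =' numeral zero succ z))

end Representation

/-! ### The Rosser-style sentence -/

section Rosser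

variable {L : FirstOrder.Language.{u, v}} [Encodable (Σ n, L.Functions n)] [Encodable (Σ n, L.Relations n)]

/-- The output that stands for rejection. -/
def reject : ℕ := 0

/-- The output that stands for acceptance. -/
def accept : ℕ := 1

/-- The sentence `f(⌜F⌝) = accept`, where the formula `F` represents `f` and `⌜F⌝` is the numeral
of its own number. -/
def diagonal (zero : L.Constants) (succ : L.Functions 1) (F : L.Formula (Fin 2)) : L.Sentence :=
  valueEq zero succ F ![code F] accept

/-- The negation of `diagonal`. For a representation `F` of the search below this is the
Rosser-style sentence. -/
def rosser (zero : L.Constants) (succ : L.Functions 1) (F : L.Formula (Fin 2)) : L.Sentence :=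
  Formula.not (diagonal zero succ F)

/-- On the number of a formula `F` with two free variables, `X` goes through `p = 0, 1, 2, …` until
`p` proves `¬ f(⌜F⌝) = accept`, and then returns `accept`, or `p` proves `f(⌜F⌝) = accept`, and
then returns `reject`; the first of these is tested first, and if there is no such `p` then `X`
does not halt. On all other inputs `X` is arbitrary. -/
def IsRosserSearch (zero : L.Constants) (succ : L.Functions 1) (pc : ℕ → ℕ → Bool)
    (X : (Fin 1 → ℕ) →. ℕ) : Prop :=
  ∀ F : L.Formula (Fin 2),
    X ![code F] =
      (Nat.rfind fun p => Part.some
        (pc p (code (rosser zero succ F)) || pc p (code (diagonal zero succ F)))).map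
      fun p => if pc p (code (rosser zero succ F)) = true then accept else reject

end Rosser

end Incompleteness

/-! Write D for X(#F) = ✓, so that R is ¬D. If T proves R, the search halts; by consistency nothing
proves D, so it stops at a proof of R and X(#F) = ✓. Representation then puts D in T, a
contradiction (`rosser_notMem`). If T proves ¬R, it proves D; the search stops at a proof of D, so
X(#F) = ✗, and T proves this too. Uniqueness of the value makes 0 and S0 equal in every model,
against Sx ≠ 0; hence T has no model and proves R, which was just excluded (`not_rosser_notMem`).

No fixed-point lemma is needed: X is fed the number of the formula that represents it. The longer
task is to find a computable X (`exists_rosserSearch`), for which #F ↦ #D must be computable.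
Substitution is a `flatMap` over the letters of a string, which makes this map primitive recursive.
-/

namespace Incompleteness

open FirstOrder FirstOrder.Language

/-! ### Substitution on strings

Substitution and relabelling of variables act letter by letter on the strings of formulas, so that
they are primitive recursive whatever the numbering of the symbols. -/

section Strings

theorem encode_fin {n : ℕ} (i : Fin n) : Encodable.encode i = (i : ℕ) := rfl

/-- Replace a letter that stands for the variable number `b` by the string `v b`, and keep every
other letter. -/
def substLetter (v : ℕ → List ℕ) (a : ℕ) : List ℕ :=
  -- The bound `4 ≤ a` excludes the letter `1` of equality, which is also 1 modulo 3.
  if 4 ≤ a ∧ a % 3 = 1 then v ((a - 4) / 3) else [a]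

theorem substLetter_var (v : ℕ → List ℕ) (b : ℕ) : substLetter v (3 * b + 4) = v b := by
  rw [substLetter, if_pos (by omega)]
  congr 1
  omega

theorem substLetter_func (v : ℕ → List ℕ) (a : ℕ) :
    substLetter v (3 * a + 5) = [3 * a + 5] :=
  if_neg (by omega)

theorem substLetter_rel (v : ℕ → List ℕ) (a : ℕ) :
    substLetter v (3 * a + 6) = [3 * a + 6] :=
  if_neg (by omega)

theorem substLetter_logical (v : ℕ → List ℕ) {a : ℕ} (h : a < 4) : substLetter v a = [a] :=
  if_neg (by omega)

variable {L : FirstOrder.Language.{u, v}}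

theorem relabel_numeral (zero : L.Constants) (succ : L.Functions 1) {β γ : Type} (g : β → γ)
    (x : ℕ) : (numeral zero succ x : L.Term β).relabel g = numeral zero succ x := by
  induction x with
  | zero =>
    simp only [numeral, Constants.term, Term.relabel]
    exact congrArg _ (Subsingleton.elim _ _)
  | succ x ih =>
    simp only [numeral, Functions.apply₁, Term.relabel]
    congr 1
    ext i
    fin_cases i
    exact ih

variable [Encodable (Σ n, L.Functions n)]

theorem termString_subst {β γ : Type} [Encodable β] [Encodable γ] (f : β → L.Term γ)
    {v : ℕ → List ℕ} (hv : ∀ b, v (Encodable.encode b) = termString (f b)) (t : L.Term β) :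
    termString (t.subst f) = (termString t).flatMap (substLetter v) := by
  induction t with
  | var b => simp [Term.subst, termString, substLetter_var, hv]
  | func g ts ih =>
    simp [Term.subst, termString, substLetter_func, ih, List.flatMap_assoc]

theorem termString_relabel {β γ : Type} [Encodable β] [Encodable γ] (g : β → γ)
    {v : ℕ → List ℕ} (hv : ∀ b, v (Encodable.encode b) = [3 * Encodable.encode (g b) + 4])
    (t : L.Term β) :
    termString (t.relabel g) = (termString t).flatMap (substLetter v) := by
  induction t with
  | var b => simp [Term.relabel, termString, substLetter_var, hv]
  | func g ts ih =>
    simp [Term.relabel, termString, substLetter_func, ih, List.flatMap_assoc]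

theorem termString_relabel_eq {β γ : Type} [Encodable β] [Encodable γ] (g : β → γ)
    (hg : ∀ b, Encodable.encode (g b) = Encodable.encode b) (t : L.Term β) :
    termString (t.relabel g) = termString t := by
  induction t with
  | var b => simp [Term.relabel, termString, hg]
  | func g ts ih => simp [Term.relabel, termString, ih]

/-- The string of the numeral of `x`. -/
def numeralString (zero : L.Constants) (succ : L.Functions 1) (x : ℕ) : List ℕ :=
  (List.range x).map (fun _ => 3 * Encodable.encode (⟨1, succ⟩ : Σ n, L.Functions n) + 5) ++
    [3 * Encodable.encode (⟨0, zero⟩ : Σ n, L.Functions n) + 5]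

theorem termString_numeral (zero : L.Constants) (succ : L.Functions 1) {β : Type} [Encodable β]
    (x : ℕ) : termString (numeral zero succ x : L.Term β) = numeralString zero succ x := by
  induction x with
  | zero => simp [numeral, Constants.term, termString, numeralString]
  | succ x ih =>
    simp [numeral, Functions.apply₁, termString, ih, numeralString, List.replicate_succ,
      List.finRange_succ]

variable [Encodable (Σ n, L.Relations n)]

/-- The letter of a bound variable depends on its index alone, not on how many variables are bound.
-/
theorem formulaString_castLE {α : Type} [Encodable α] {m n : ℕ} (h : m ≤ n)
    (A : L.BoundedFormula α m) : formulaString (A.castLE h) = formulaString A := by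
  have key : ∀ {m n : ℕ} (h : m ≤ n) (t : L.Term (α ⊕ Fin m)),
      termString (t.relabel (Sum.map id (Fin.castLE h))) = termString t := fun h t =>
    termString_relabel_eq _ (by rintro (a | i) <;> simp [encode_fin]) t
  induction A generalizing n with
  | falsum => rfl
  | equal t₁ t₂ => simp [BoundedFormula.castLE, formulaString, key]
  | rel R ts => simp [BoundedFormula.castLE, formulaString, key]
  | imp A B ihA ihB => simp [BoundedFormula.castLE, formulaString, ihA, ihB]
  | all A ih => simp [BoundedFormula.castLE, formulaString, ih]

/-- Common core of `subst` and `relabel`: connectives, quantifiers and relation symbols are fixed by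
`substLetter`, so it suffices to treat terms, with one `v` serving at all quantifier depths. -/
theorem formulaString_mapTermRel {α β : Type} [Encodable α] [Encodable β] {g : ℕ → ℕ}
    (ft : ∀ n, L.Term (α ⊕ Fin n) → L.Term (β ⊕ Fin (g n)))
    (h : ∀ n, L.BoundedFormula β (g (n + 1)) → L.BoundedFormula β (g n + 1))
    {v : ℕ → List ℕ}
    (hft : ∀ n t, termString (ft n t) = (termString t).flatMap (substLetter v))
    (hh : ∀ n A, formulaString (h n A) = formulaString A)
    {n : ℕ} (A : L.BoundedFormula α n) :
    formulaString (A.mapTermRel ft (fun _ => id) h) =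
      (formulaString A).flatMap (substLetter v) := by
  induction A with
  | falsum => simp [BoundedFormula.mapTermRel, formulaString, substLetter_logical]
  | equal t₁ t₂ => simp [BoundedFormula.mapTermRel, formulaString, substLetter_logical, hft]
  | rel R ts =>
    simp [BoundedFormula.mapTermRel, formulaString, substLetter_rel, hft, List.flatMap_assoc]
  | imp A B ihA ihB =>
    simp [BoundedFormula.mapTermRel, formulaString, substLetter_logical, ihA, ihB]
  | all A ih => simp [BoundedFormula.mapTermRel, formulaString, substLetter_logical, hh, ih]

/-- The strings put for the variables by `applyTo`, when there is a single argument, with string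
`N`, and the last variable stays a variable. -/
def applyToVar (N : List ℕ) (b : ℕ) : List ℕ :=
  -- A disjoint sum numbers `inl i` by `2 * i` and `inr i` by `2 * i + 1`. The two free variables
  -- thus have numbers 0 and 2; the second becomes free variable 0, with letter 4.
  if b = 0 then N else if b = 2 then [4] else [3 * b + 4]

theorem applyToVar_odd (N : List ℕ) (i : ℕ) :
    applyToVar N (2 * i + 1) = [3 * (2 * i + 1) + 4] := by
  rw [applyToVar, if_neg (by omega), if_neg (by omega)]

/-- The strings put for the variables by `atVar`. -/
def atVarVar (n j b : ℕ) : List ℕ :=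
  -- An even number is a free variable and becomes bound variable `j`; an odd one is a bound
  -- variable, whose index goes up by `n`.
  if b % 2 = 0 then [3 * (2 * j + 1) + 4] else [3 * (b + 2 * n) + 4]

theorem atVarVar_odd (n j i : ℕ) : atVarVar n j (2 * i + 1) = [3 * (2 * (n + i) + 1) + 4] := by
  rw [atVarVar, if_neg (by omega)]
  congr 1
  ring

theorem formulaString_applyTo (zero : L.Constants) (succ : L.Functions 1)
    (F : L.Formula (Fin 2)) (x : ℕ) :
    formulaString (applyTo zero succ F ![x] (Term.var 0 : L.Term (Fin 1))) =
      (formulaString F).flatMap (substLetter (applyToVar (numeralString zero succ x))) := by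
  refine formulaString_mapTermRel (g := id) _ (fun _ => id)
    (fun n t => termString_subst (β := Fin 2 ⊕ Fin n) (γ := Fin 1 ⊕ Fin n) _ ?_ t)
    (fun _ _ => rfl) F
  rintro (i | i)
  · fin_cases i
    · simp [encode_fin, applyToVar, Fin.snoc, relabel_numeral, termString_numeral]
    · simp [encode_fin, applyToVar, Fin.snoc, Term.relabel, termString]
  · rw [Encodable.encode_inr, applyToVar_odd]
    rfl

theorem formulaString_atVar (P : L.Formula (Fin 1)) {n : ℕ} (j : Fin n) :
    formulaString (atVar P j) = (formulaString P).flatMap (substLetter (atVarVar n j)) := by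
  refine formulaString_mapTermRel _ _ (fun k t => termString_relabel _ ?_ t)
    (fun _ A => formulaString_castLE _ A) P
  rintro (i | i)
  · simp [encode_fin, atVarVar, BoundedFormula.relabelAux]
  · rw [Encodable.encode_inr, atVarVar_odd]
    simp [encode_fin, BoundedFormula.relabelAux]

/-- The string of a negation. -/
def notString (s : List ℕ) : List ℕ := 2 :: (s ++ [0])

/-- The string of a conjunction. -/
def andString (s t : List ℕ) : List ℕ := notString (2 :: (s ++ notString t))

/-- The string of an existential quantification. -/
def exString (s : List ℕ) : List ℕ := notString (3 :: notString s)

/-- The string of `valueEq`, from the string `N` of the numeral of the value, and the strings `P`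
and `Q` of the graph at the first and at the second bound variable. -/
def valueEqString (N P Q : List ℕ) : List ℕ :=
  -- Bound variables 0 and 1 have numbers 1 and 3, hence letters 7 and 13.
  andString (exString (andString P (3 :: 2 :: (Q ++ [1, 13, 7]))))
    (exString (andString P (1 :: 7 :: N)))

theorem formulaString_valueEq (zero : L.Constants) (succ : L.Functions 1)
    (F : L.Formula (Fin 2)) (x : Fin 1 → ℕ) (z : ℕ) :
    formulaString (valueEq zero succ F x z) =
      valueEqString (numeralString zero succ z)
        (formulaString (atVar (applyTo zero succ F x (Term.var 0)) (0 : Fin 1)))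
        (formulaString (atVar (applyTo zero succ F x (Term.var 0)) (1 : Fin 2))) := by
  rw [← termString_numeral (β := Empty ⊕ Fin 1)]
  rfl

/-- The string of `diagonal`, from the number of a formula. -/
def diagonalString (zero : L.Constants) (succ : L.Functions 1) (c : ℕ) : List ℕ :=
  -- The diagonalization: `c` is used both as the string to substitute into and as the numeral
  -- substituted.
  let P := ((Encodable.decode (α := List ℕ) c).getD []).flatMap
    (substLetter (applyToVar (numeralString zero succ c)))
  valueEqString (numeralString zero succ accept)
    (P.flatMap (substLetter (atVarVar 1 0))) (P.flatMap (substLetter (atVarVar 2 1)))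

theorem formulaString_diagonal (zero : L.Constants) (succ : L.Functions 1)
    (F : L.Formula (Fin 2)) :
    formulaString (diagonal zero succ F) = diagonalString zero succ (code F) := by
  rw [diagonal, formulaString_valueEq, formulaString_atVar, formulaString_atVar,
    formulaString_applyTo]
  simp [diagonalString, code]

theorem code_diagonal (zero : L.Constants) (succ : L.Functions 1) (F : L.Formula (Fin 2)) :
    code (diagonal zero succ F) = Encodable.encode (diagonalString zero succ (code F)) := by
  rw [code, formulaString_diagonal]

theorem code_rosser (zero : L.Constants) (succ : L.Functions 1) (F : L.Formula (Fin 2)) :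
    code (rosser zero succ F) =
      Encodable.encode (notString (diagonalString zero succ (code F))) := by
  rw [← formulaString_diagonal]
  rfl

end Strings

/-! ### Computability of the search -/

section Computability

theorem primrec_notString : Primrec notString :=
  Primrec.list_cons.comp (Primrec.const 2) (Primrec.list_append.comp Primrec.id (Primrec.const [0]))

theorem primrec_andString : Primrec₂ andString :=
  primrec_notString.comp <| Primrec.list_cons.comp (Primrec.const 2) <|
    Primrec.list_append.comp Primrec.fst (primrec_notString.comp Primrec.snd)

theorem primrec_exString : Primrec exString :=
  primrec_notString.comp <| Primrec.list_cons.comp (Primrec.const 3) primrec_notString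

theorem primrec_valueEqString (N : List ℕ) : Primrec₂ (valueEqString N) :=
  primrec_andString.comp
    (primrec_exString.comp <| primrec_andString.comp Primrec.fst <|
      Primrec.list_cons.comp (Primrec.const 3) <| Primrec.list_cons.comp (Primrec.const 2) <|
        Primrec.list_append.comp Primrec.snd (Primrec.const _))
    (primrec_exString.comp <| primrec_andString.comp Primrec.fst (Primrec.const _))

theorem primrec_flatMap_substLetter {α : Type} [Primcodable α] {s : α → List ℕ}
    {v : α → ℕ → List ℕ} (hs : Primrec s) (hv : Primrec₂ v) :
    Primrec fun a => (s a).flatMap (substLetter (v a)) := by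
  refine Primrec.list_flatMap hs (Primrec.ite (PrimrecPred.and ?_ ?_) ?_ ?_)
  · exact Primrec.nat_le.comp (Primrec.const 4) Primrec.snd
  · exact Primrec.eq.comp (Primrec.nat_mod.comp Primrec.snd (Primrec.const 3)) (Primrec.const 1)
  · exact hv.comp Primrec.fst (Primrec.nat_div.comp
      (Primrec.nat_sub.comp Primrec.snd (Primrec.const 4)) (Primrec.const 3))
  · exact Primrec.list_cons.comp Primrec.snd (Primrec.const [])

theorem primrec_applyToVar : Primrec₂ applyToVar := by
  refine Primrec.ite (Primrec.eq.comp Primrec.snd (Primrec.const 0)) Primrec.fst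
    (Primrec.ite (Primrec.eq.comp Primrec.snd (Primrec.const 2)) (Primrec.const [4])
      (Primrec.list_cons.comp ?_ (Primrec.const [])))
  exact Primrec.nat_add.comp (Primrec.nat_mul.comp (Primrec.const 3) Primrec.snd) (Primrec.const 4)

theorem primrec_atVarVar (n j : ℕ) : Primrec (atVarVar n j) := by
  refine Primrec.ite
    (Primrec.eq.comp (Primrec.nat_mod.comp Primrec.id (Primrec.const 2)) (Primrec.const 0))
    (Primrec.const _) (Primrec.list_cons.comp ?_ (Primrec.const []))
  exact Primrec.nat_add.comp (Primrec.nat_mul.comp (Primrec.const 3)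
    (Primrec.nat_add.comp Primrec.id (Primrec.const (2 * n)))) (Primrec.const 4)

variable {L : FirstOrder.Language.{u, v}} [Encodable (Σ n, L.Functions n)]

/-- The numbering of the symbols enters only through the numbers of `zero` and `succ`, two
constants, so it need not be computable. -/
theorem primrec_numeralString (zero : L.Constants) (succ : L.Functions 1) :
    Primrec (numeralString zero succ) :=
  Primrec.list_append.comp
    (Primrec.list_map Primrec.list_range (Primrec.const _).to₂) (Primrec.const _)

theorem primrec_diagonalString (zero : L.Constants) (succ : L.Functions 1) :
    Primrec (diagonalString zero succ) := by
  have hP : Primrec fun c => ((Encodable.decode (α := List ℕ) c).getD []).flatMap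
      (substLetter (applyToVar (numeralString zero succ c))) :=
    primrec_flatMap_substLetter
      (Primrec.option_getD.comp Primrec.decode (Primrec.const []))
      (primrec_applyToVar.comp ((primrec_numeralString zero succ).comp Primrec.fst) Primrec.snd)
  exact (primrec_valueEqString _).comp
    (primrec_flatMap_substLetter hP ((primrec_atVarVar 1 0).comp Primrec.snd))
    (primrec_flatMap_substLetter hP ((primrec_atVarVar 2 1).comp Primrec.snd))

/-- The search for a proof of one of two sentences whose numbers are computed from the input. -/
theorem partrec_search {pc : ℕ → ℕ → Bool} (hpc : Computable₂ pc) {r d : ℕ → ℕ}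
    (hr : Computable r) (hd : Computable d) :
    Partrec fun x : Fin 1 → ℕ =>
      (Nat.rfind fun p => Part.some (pc p (r (x 0)) || pc p (d (x 0)))).map
        fun p => if pc p (r (x 0)) = true then accept else reject := by
  have h0 : Computable fun x : Fin 1 → ℕ => x 0 :=
    (Primrec.fin_app.comp Primrec.id (Primrec.const 0)).to_comp
  have hR : Computable₂ fun (x : Fin 1 → ℕ) p => pc p (r (x 0)) :=
    hpc.comp Computable.snd (hr.comp (h0.comp Computable.fst))
  have hD : Computable₂ fun (x : Fin 1 → ℕ) p => pc p (d (x 0)) :=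
    hpc.comp Computable.snd (hd.comp (h0.comp Computable.fst))
  have hor : Computable₂ fun (x : Fin 1 → ℕ) p => pc p (r (x 0)) || pc p (d (x 0)) :=
    Primrec.or.to_comp.comp hR hD
  refine (Partrec.rfind hor.partrec₂).map ?_
  refine (Computable.cond hR (Computable.const accept) (Computable.const reject)).of_eq ?_
  rintro ⟨x, p⟩
  cases h : pc p (r (x 0)) <;> simp [h]

theorem exists_rosserSearch [Encodable (Σ n, L.Relations n)] (zero : L.Constants)
    (succ : L.Functions 1) {pc : ℕ → ℕ → Bool} (hpc : Computable₂ pc) :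
    ∃ X : (Fin 1 → ℕ) →. ℕ, Partrec X ∧ IsRosserSearch (L := L) zero succ pc X := by
  have hd := primrec_diagonalString zero succ
  refine ⟨_, partrec_search hpc
    (Primrec.encode.comp (primrec_notString.comp hd)).to_comp
    (Primrec.encode.comp hd).to_comp, fun F => ?_⟩
  simp only [code_rosser, code_diagonal, Matrix.cons_val_zero]
  rfl

end Computability

/-! ### Semantics of the sentences involved -/

section Semantics

variable {L : FirstOrder.Language.{u, v}} {M : Type*} [L.Structure M]

theorem realize_numeral_congr (zero : L.Constants) (succ : L.Functions 1) {β γ : Type}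
    (v : β → M) (w : γ → M) (x : ℕ) :
    (numeral zero succ x : L.Term β).realize v = (numeral zero succ x : L.Term γ).realize w := by
  induction x with
  | zero => simp [numeral]
  | succ x ih => simp [numeral, ih]

theorem realize_atVar (P : L.Formula (Fin 1)) {n : ℕ} (j : Fin n) (v : Empty → M)
    (xs : Fin n → M) : (atVar P j).Realize v xs ↔ P.Realize fun _ => xs j := by
  rw [atVar, Formula.Realize]
  refine BoundedFormula.realize_relabel.trans ?_
  rw [Subsingleton.elim (xs ∘ Fin.natAdd n : Fin 0 → M) default]
  rfl

theorem realize_existsUnique (P : L.Formula (Fin 1)) :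
    M ⊨ existsUnique P ↔ ∃! a : M, P.Realize fun _ => a := by
  simp [existsUnique, Sentence.Realize, Formula.Realize, realize_atVar, ExistsUnique, Fin.snoc]

/-- Turns every instance of `F` into one predicate on `M`, evaluated at the value of `t`, so that
uniqueness can compare different terms. -/
theorem realize_applyTo (zero : L.Constants) (succ : L.Functions 1) {k : ℕ} {β : Type}
    (F : L.Formula (Fin (k + 1))) (x : Fin k → ℕ) (t : L.Term β) (v : β → M) :
    (applyTo zero succ F x t).Realize v ↔
      (applyTo zero succ F x (Term.var 0 : L.Term (Fin 1))).Realize fun _ => t.realize v := by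
  simp only [applyTo, Formula.Realize, BoundedFormula.realize_subst]
  refine iff_of_eq (congrArg (fun w => BoundedFormula.Realize F w default) ?_)
  funext i
  refine Fin.lastCases ?_ (fun i => ?_) i
  · simp
  · simpa using realize_numeral_congr zero succ _ _ _

/-- The one-point rule `(∃ y, F y ∧ y = z) ↔ F z` links the sentence in `IsRepresentation` to
`valueEq`. -/
theorem realize_valueEq (zero : L.Constants) (succ : L.Functions 1) {k : ℕ}
    (F : L.Formula (Fin (k + 1))) (x : Fin k → ℕ) (z : ℕ) :
    M ⊨ valueEq zero succ F x z ↔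
      M ⊨ (existsUnique (applyTo zero succ F x (Term.var 0)) ⊓
        applyTo zero succ F x (numeral zero succ z) : L.Sentence) := by
  have h : M ⊨ (applyTo zero succ F x (numeral zero succ z) : L.Sentence) ↔
      M ⊨ (∃' (atVar (applyTo zero succ F x (Term.var 0)) (0 : Fin 1) ⊓
        ((&0) =' numeral zero succ z)) : L.Sentence) := by
    rw [Sentence.Realize, realize_applyTo]
    simp [Sentence.Realize, Formula.Realize, realize_atVar, Fin.snoc,
      realize_numeral_congr zero succ _ (default : Empty → M)]
  simp only [Sentence.Realize, valueEq, Formula.realize_inf] at h ⊢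
  rw [h]

theorem eq_of_realize_valueEq {zero : L.Constants} {succ : L.Functions 1} {k : ℕ}
    {F : L.Formula (Fin (k + 1))} {x : Fin k → ℕ} {y z : ℕ}
    (hy : M ⊨ valueEq zero succ F x y) (hz : M ⊨ valueEq zero succ F x z) :
    (numeral zero succ y : L.Term Empty).realize (default : Empty → M) =
      (numeral zero succ z : L.Term Empty).realize default := by
  rw [realize_valueEq, Sentence.Realize, Formula.realize_inf] at hy hz
  exact ((realize_existsUnique _).1 hy.1).unique
    ((realize_applyTo zero succ F x _ _).1 hy.2) ((realize_applyTo zero succ F x _ _).1 hz.2)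

theorem realize_numeral_reject_ne_accept {zero : L.Constants} {succ : L.Functions 1}
    (h : M ⊨ successorAxioms zero succ) :
    (numeral zero succ reject : L.Term Empty).realize (default : Empty → M) ≠
      (numeral zero succ accept : L.Term Empty).realize default := by
  have h0 : M ⊨ (∀' ∼((succ.apply₁ (&0)) =' zero.term) : L.Sentence) :=
    h.realize_of_mem _ (by simp [successorAxioms])
  simp only [Sentence.Realize, Formula.Realize, BoundedFormula.realize_all,
    BoundedFormula.realize_not, BoundedFormula.realize_bdEqual, Term.realize_functions_apply₁,
    Term.realize_constants] at h0
  simpa [reject, accept, numeral, Fin.snoc] using Ne.symm (h0 (zero : M))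

end Semantics

/-! ### Undecidability of the Rosser-style sentence -/

section Rosser

variable {L : FirstOrder.Language.{u, v}} {T : L.Theory}

theorem IsDeductivelyClosed.mem_of_realize (hT : IsDeductivelyClosed T) {A : L.Sentence}
    (h : ∀ M : Theory.ModelType.{u, v, max u v} T, M ⊨ A) : A ∈ T :=
  hT A (Theory.models_sentence_iff.2 h)

theorem IsRepresentation.valueEq_mem {zero : L.Constants} {succ : L.Functions 1}
    (hT : IsDeductivelyClosed T) {k : ℕ} {f : (Fin k → ℕ) →. ℕ} {F : L.Formula (Fin (k + 1))}
    (hF : IsRepresentation zero succ T f F) {x : Fin k → ℕ} {y : ℕ} (hy : y ∈ f x) :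
    valueEq zero succ F x y ∈ T :=
  hT.mem_of_realize fun _ =>
    (realize_valueEq zero succ F x y).2 (Theory.realize_sentence_of_mem T (hF x y hy))

variable [Encodable (Σ n, L.Functions n)] [Encodable (Σ n, L.Relations n)]
  {zero : L.Constants} {succ : L.Functions 1} {pc : ℕ → ℕ → Bool} {X : (Fin 1 → ℕ) →. ℕ}

theorem accept_mem_of_rosser_mem (hcons : IsConsistent T) (hpc : IsProofVerifier T pc)
    (hX : IsRosserSearch (L := L) zero succ pc X) {F : L.Formula (Fin 2)}
    (hR : rosser zero succ F ∈ T) : accept ∈ X ![code F] := by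
  obtain ⟨p, hp⟩ := (hpc _).1 hR
  obtain ⟨q, hq, -⟩ := Nat.rfind_min'
    (p := fun p => pc p (code (rosser zero succ F)) || pc p (code (diagonal zero succ F)))
    (m := p) (by simp [hp])
  -- The first hit `q` may differ from `p`, but consistency rules out that it proves the diagonal
  -- sentence.
  have hqD : pc q (code (diagonal zero succ F)) = false := (hpc _).2 (fun h => hcons _ ⟨h, hR⟩) q
  have hqR : pc q (code (rosser zero succ F)) = true := by simpa [hqD] using Nat.rfind_spec hq
  rw [hX F, Part.mem_map_iff]
  exact ⟨q, hq, by simp [hqR]⟩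

theorem reject_mem_of_diagonal_mem (hcons : IsConsistent T) (hpc : IsProofVerifier T pc)
    (hX : IsRosserSearch (L := L) zero succ pc X) {F : L.Formula (Fin 2)}
    (hD : diagonal zero succ F ∈ T) : reject ∈ X ![code F] := by
  obtain ⟨p, hp⟩ := (hpc _).1 hD
  obtain ⟨q, hq, -⟩ := Nat.rfind_min'
    (p := fun p => pc p (code (rosser zero succ F)) || pc p (code (diagonal zero succ F)))
    (m := p) (by simp [hp])
  have hqR : pc q (code (rosser zero succ F)) = false := (hpc _).2 (fun h => hcons _ ⟨hD, h⟩) q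
  rw [hX F, Part.mem_map_iff]
  exact ⟨q, hq, by simp [hqR]⟩

theorem rosser_notMem (hT : IsDeductivelyClosed T) (hcons : IsConsistent T)
    (hpc : IsProofVerifier T pc) (hX : IsRosserSearch (L := L) zero succ pc X)
    {F : L.Formula (Fin 2)} (hF : IsRepresentation zero succ T X F) :
    rosser zero succ F ∉ T := fun hR =>
  hcons _ ⟨hF.valueEq_mem hT (accept_mem_of_rosser_mem hcons hpc hX hR), hR⟩

theorem not_rosser_notMem (hT : IsDeductivelyClosed T) (hsucc : successorAxioms zero succ ⊆ T)
    (hcons : IsConsistent T) (hpc : IsProofVerifier T pc)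
    (hX : IsRosserSearch (L := L) zero succ pc X)
    {F : L.Formula (Fin 2)} (hF : IsRepresentation zero succ T X F) :
    Formula.not (rosser zero succ F) ∉ T := fun hN => by
  have hD : diagonal zero succ F ∈ T := hT.mem_of_realize fun M => by
    have h := Theory.realize_sentence_of_mem (M := M) T hN
    simpa [rosser, Sentence.Realize] using h
  have h0 := hF.valueEq_mem hT (reject_mem_of_diagonal_mem hcons hpc hX hD)
  -- No model of `T` exists, so `R` holds in all of them vacuously and would belong to `T`.
  refine rosser_notMem hT hcons hpc hX hF (hT.mem_of_realize fun M => ?_)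
  have hM : M ⊨ successorAxioms zero succ := Theory.Model.mono inferInstance hsucc
  exact (realize_numeral_reject_ne_accept hM (eq_of_realize_valueEq
    (Theory.realize_sentence_of_mem T h0) (Theory.realize_sentence_of_mem T hD))).elim

end Rosser

end Incompleteness

theorem mainTheorem3 {L : FirstOrder.Language.{u, v}}
    [Encodable (Σ n, L.Functions n)] [Encodable (Σ n, L.Relations n)]
    (zero : L.Constants) (succ : L.Functions 1) (T : L.Theory)
    (hclosed : Incompleteness.IsDeductivelyClosed T)
    (hsucc : Incompleteness.successorAxioms zero succ ⊆ T)
    (hcons : Incompleteness.IsConsistent T)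
    (hce : Incompleteness.IsComputablyEnumerable T)
    (hrep : Incompleteness.RepresentsEveryComputable zero succ T) :
    Incompleteness.IsIncomplete T ∧
    ∀ pc : ℕ → ℕ → Bool, Computable₂ pc → Incompleteness.IsProofVerifier T pc →
      (∃ X : (Fin 1 → ℕ) →. ℕ,
        Partrec X ∧ Incompleteness.IsRosserSearch (L := L) zero succ pc X) ∧
      ∀ X : (Fin 1 → ℕ) →. ℕ,
        Partrec X → Incompleteness.IsRosserSearch (L := L) zero succ pc X →
        (∃ F : L.Formula (Fin 2), Incompleteness.IsRepresentation zero succ T X F) ∧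
        ∀ F : L.Formula (Fin 2), Incompleteness.IsRepresentation zero succ T X F →
          Incompleteness.rosser zero succ F ∉ T ∧
          FirstOrder.Language.Formula.not (Incompleteness.rosser zero succ F) ∉ T := by

  have main : ∀ pc : ℕ → ℕ → Bool, Computable₂ pc → Incompleteness.IsProofVerifier T pc →
      (∃ X : (Fin 1 → ℕ) →. ℕ,
        Partrec X ∧ Incompleteness.IsRosserSearch (L := L) zero succ pc X) ∧
      ∀ X : (Fin 1 → ℕ) →. ℕ,
        Partrec X → Incompleteness.IsRosserSearch (L := L) zero succ pc X →
        (∃ F : L.Formula (Fin 2), Incompleteness.IsRepresentation zero succ T X F) ∧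
        ∀ F : L.Formula (Fin 2), Incompleteness.IsRepresentation zero succ T X F →
          Incompleteness.rosser zero succ F ∉ T ∧
          FirstOrder.Language.Formula.not (Incompleteness.rosser zero succ F) ∉ T :=
    fun pc hcomp hpc => ⟨Incompleteness.exists_rosserSearch zero succ hcomp,
      fun X hXc hX => ⟨hrep 1 X hXc, fun F hF =>
        ⟨Incompleteness.rosser_notMem hclosed hcons hpc hX hF,
          Incompleteness.not_rosser_notMem hclosed hsucc hcons hpc hX hF⟩⟩⟩
  refine ⟨?_, main⟩
  obtain ⟨pc, hcomp, hpc⟩ := hce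
  obtain ⟨⟨X, hXc, hX⟩, hall⟩ := main pc hcomp hpc
  obtain ⟨⟨F, hF⟩, hund⟩ := hall X hXc hX
  exact ⟨_, hund F hF⟩
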